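/- Let $a,b,r:[0,\infty)\to\mathbb R$, $c:[0,\infty)^2\to\mathbb R$ and $d\in\mathbb R$ satisfy the following conditions. (i1) $a\in L^1[0,\infty)$, $a\ge 0$ almost everywhere, and $\int_0^\infty a(s)\,ds=1$. (i2) $b\in L^1[0,\infty)$ and $d>0$. (i3) $r\in L^1[0,\infty)$ is nonnegative and continuous. (i4) $c$ is jointly measurable, $s\mapsto c_{t,s}$ is integrable on $[0,t]$ for every $t>0$, and $\lim_{t\to\infty}c_{t,s}=0$ for a.e. $s>0$. (i5)–(i6) There is $z>1$ such that $\int_0^\infty a(t)z^t\,dt<\infty$, $\int_0^\infty|b(t)|z^t\,dt<\infty$, and the functions $t\mapsto z^t\int_0^t|c_{t,s}|\,ds$ and $t\mapsto r(t)z^t$ are directly Riemann integrable on $[0,\infty)$. (A nonnegative function $h$ is directly Riemann integrable on $[0,\infty)$ if it is Riemann integrable on every finite interval and $\sum_{n\ge1}\sup_{n\tau\le\theta\le(n+1)\tau}h(\theta)<\infty$ for every $\tau>0$; a real function is so if its positive and negative parts are.) Suppose that the kernel $w_{t,s}=a(s)+\frac{b(s)}{t+d}+c_{t,s}$ satisfies,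 for every $t>0$, $w_{t,s}\ge0$ for a.e. $s\in[0,t]$. Let $g:[0,\infty)\to[0,\infty)$ be a nonnegative function, continuous on $(0,\infty)$ and bounded on $[0,1]$ (for instance, continuous on $[0,\infty)$), with $g(0)=1$ and $$g(t)=\int_0^t w_{t,s}\,g(t-s)\,ds+r(t)\qquad(t>0),$$ and suppose that for every $T>0$ there is $t>T$ with $g(t)>0$. Put $$\gamma=\frac{\int_0^\infty b(s)\,ds}{\int_0^\infty s\,a(s)\,ds}.$$ Then for every $T>0$ $$0<\liminf_{t\to\infty}g(t)t^{-\gamma}\le\sup_{t\ge T}g(t)t^{-\gamma}<\infty,$$ and if $\gamma\le 0$ the same holds with the supremum over all $t\ge0$ (where $0^0=1$). -/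

import Mathlib

open MeasureTheory Set Filter Topology

noncomputable section

namespace VolterraRenewal

/-- `h` is Riemann integrable on `[x, y]`: the Riemann sums over tagged partitions converge as the
mesh tends to `0` (Mathlib's Riemann box integral, in dimension one). -/
def RiemannIntegrable (h : ℝ → ℝ) (x y : ℝ) (hxy : x < y) : Prop :=
  BoxIntegral.Integrable
    (⟨fun _ => x, fun _ => y, fun _ => hxy⟩ : BoxIntegral.Box (Fin 1))
    BoxIntegral.IntegrationParams.Riemann
    (fun v => h (v 0))
    BoxIntegral.BoxAdditiveMap.volume

/-- Direct Riemann integrability on `[0, ∞)` of a function that is nonnegative there. -/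
def NonnegDRI (h : ℝ → ℝ) : Prop :=
  (∀ (x y : ℝ) (hxy : x < y), 0 ≤ x → RiemannIntegrable h x y hxy) ∧
  ∀ τ : ℝ, 0 < τ →
    (∑' n : ℕ, ⨆ θ ∈ Icc (((n : ℝ) + 1) * τ) (((n : ℝ) + 2) * τ), ENNReal.ofReal (h θ)) < ⊤

/-- Direct Riemann integrability on `[0, ∞)` of a real function, through its positive and negative
parts. -/
def DirectlyRiemannIntegrable (h : ℝ → ℝ) : Prop :=
  NonnegDRI (fun t => max (h t) 0) ∧ NonnegDRI (fun t => max (-h t) 0)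

/-- The kernel `w_{t,s} = a(s) + b(s) / (t + d) + c_{t,s}`. -/
def kernel (a b : ℝ → ℝ) (c : ℝ → ℝ → ℝ) (d t s : ℝ) : ℝ :=
  a s + b s / (t + d) + c t s

/-- The conditions on the data of the equation; functions on `[0, ∞)` are represented by
functions on `ℝ` whose values at negative arguments play no role. -/
structure Conditions (a b : ℝ → ℝ) (c : ℝ → ℝ → ℝ) (r : ℝ → ℝ) (d : ℝ) : Prop where
  a_integrable : IntegrableOn a (Ioi 0)
  a_nonneg : ∀ᵐ s ∂volume.restrict (Ioi (0 : ℝ)), 0 ≤ a s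
  a_integral : ∫ s in Ioi (0 : ℝ), a s = 1
  b_integrable : IntegrableOn b (Ioi 0)
  d_pos : 0 < d
  r_integrable : IntegrableOn r (Ioi 0)
  r_nonneg : ∀ t, 0 ≤ t → 0 ≤ r t
  r_continuous : ContinuousOn r (Ici 0)
  /-- Joint (Lebesgue) measurability on `[0, ∞)²`. -/
  c_measurable :
    AEMeasurable (fun p : ℝ × ℝ => c p.1 p.2) (volume.restrict (Ici (0 : ℝ) ×ˢ Ici (0 : ℝ)))
  c_integrable : ∀ t, 0 < t → IntervalIntegrable (c t) volume 0 t
  c_tendsto : ∀ᵐ s ∂volume.restrict (Ioi (0 : ℝ)), Tendsto (fun t => c t s) atTop (𝓝 0)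
  exp_moments : ∃ z : ℝ, 1 < z ∧
    IntegrableOn (fun t => a t * z ^ t) (Ioi 0) ∧
    IntegrableOn (fun t => |b t| * z ^ t) (Ioi 0) ∧
    DirectlyRiemannIntegrable (fun t => z ^ t * ∫ s in (0 : ℝ)..t, |c t s|) ∧
    DirectlyRiemannIntegrable (fun t => r t * z ^ t)

/-- `g` is a nonnegative continuous solution of `g(t) = ∫_0^t w_{t,s} g(t-s) ds + r(t)`, `t > 0`,
with `g(0) = 1`. As `r(0)` need not be `1`, a jump at `0` is allowed: continuity is required on
`(0, ∞)` and boundedness near `0`, both of which follow from continuity on `[0, ∞)`. -/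
structure IsSolution (w : ℝ → ℝ → ℝ) (r g : ℝ → ℝ) : Prop where
  initial : g 0 = 1
  nonneg : ∀ t, 0 ≤ t → 0 ≤ g t
  continuousOn : ContinuousOn g (Ioi 0)
  bounded : BddAbove (g '' Icc 0 1)
  equation : ∀ t, 0 < t → g t = (∫ s in (0 : ℝ)..t, w t s * g (t - s)) + r t

/-- The exponent `γ = ∫ b(s) ds / ∫ s a(s) ds`. -/
def exponent (a b : ℝ → ℝ) : ℝ :=
  (∫ s in Ioi (0 : ℝ), b s) / ∫ s in Ioi (0 : ℝ), s * a s

/-- `g(t) t^{-γ}` as an extended real number. -/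
def scaled (g : ℝ → ℝ) (γ t : ℝ) : EReal := ((g t * t ^ (-γ) : ℝ) : EReal)

end VolterraRenewal

end

/-! The operator sends `t ^ β` to `t ^ β + (B - β A) t ^ (β - 1) + O(t ^ (β - 2))`, with `A = ∫ s
a(s) ds` and `B = ∫ b` (`Conditions.exists_kernel_expansion`). The middle term vanishes exactly for
`β = γ`, so `t ^ γ` is an almost-solution. Adding `κ t ^ (γ - 1/2)` leaves a defect `κ (A / 2) t ^
(γ - 3/2)`, which dominates the error `O(t ^ (γ - 2))`: `κ = -1` gives a strict supersolution near
infinity and `κ = 1` a strict subsolution.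

As the kernel is nonnegative, an inequality between `g` and a multiple of such a function cannot
fail for a first time (`forall_pos_of_step`), so it propagates from a compact interval to infinity.
The term `r` is exponentially small, hence absorbed in the upper bound, and nonnegative, hence
dropped in the lower one.

The lower bound needs `g > 0` on the starting interval. Positivity is carried forward by the lags at
which the kernel is positive. These have positive measure, so a Steinhaus argument yields an open
interval of admissible shifts, whose multiples cover a half-line (`IsSolution.eventually_pos`). -/

namespace VolterraRenewal

/-! ### Elementary inequalities -/

/-- Powers are dominated by exponentials. -/
lemma exists_one_add_rpow_le {z : ℝ} (hz : 1 < z) (p : ℝ) :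
    ∃ C : ℝ, 0 ≤ C ∧ ∀ s : ℝ, 0 ≤ s → (1 + s) ^ p ≤ C * z ^ s := by
  have hl : 0 < Real.log z := Real.log_pos hz
  have hz0 : 0 < z := by linarith
  obtain ⟨n, hn⟩ := exists_nat_ge p
  -- One term of the exponential series at `log z * (1 + s)`, whose exponential is `z * z ^ s`.
  refine ⟨(n.factorial : ℝ) / Real.log z ^ n * z, by positivity, fun s hs => ?_⟩
  have h1 : (1 + s) ^ p ≤ (1 + s) ^ n := by
    rw [← Real.rpow_natCast]
    exact Real.rpow_le_rpow_of_exponent_le (by linarith) hn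
  have h2 := Real.pow_div_factorial_le_exp (Real.log z * (1 + s)) (by positivity) n
  have h3 : Real.exp (Real.log z * (1 + s)) = z * z ^ s := by
    rw [← Real.rpow_def_of_pos hz0, Real.rpow_add hz0, Real.rpow_one]
  rw [h3, mul_pow, div_le_iff₀ (by positivity)] at h2
  refine h1.trans ?_
  rw [div_mul_eq_mul_div, div_mul_eq_mul_div, le_div_iff₀ (by positivity)]
  linarith

lemma exists_rpow_mul_le {z : ℝ} (hz : 1 < z) (p : ℝ) :
    ∃ C : ℝ, 0 ≤ C ∧ ∀ t : ℝ, 1 ≤ t → z ^ (-t) ≤ C * t ^ p := by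
  have hz0 : 0 < z := by linarith
  obtain ⟨C, hC, h⟩ := exists_one_add_rpow_le hz |p|
  refine ⟨C, hC, fun t ht => ?_⟩
  have ht0 : 0 < t := by linarith
  have h1 : t ^ (-p) ≤ C * z ^ t :=
    calc t ^ (-p) ≤ t ^ |p| := Real.rpow_le_rpow_of_exponent_le ht (neg_le_abs p)
      _ ≤ (1 + t) ^ |p| := Real.rpow_le_rpow ht0.le (by linarith) (abs_nonneg p)
      _ ≤ _ := h t ht0.le
  rw [Real.rpow_neg ht0.le] at h1
  rw [Real.rpow_neg hz0.le, inv_le_iff_one_le_mul₀ (by positivity)]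
  rw [inv_le_iff_one_le_mul₀ (by positivity)] at h1
  linarith

/-- If `1 ≤ y ≤ t ≤ y + s`, then `y ^ p` and `t ^ p` agree up to a power of `1 + s`. -/
lemma rpow_le_rpow_mul_one_add {p y t s : ℝ} (hy : 1 ≤ y) (hyt : y ≤ t) (hs : t ≤ y + s) :
    y ^ p ≤ t ^ p * (1 + s) ^ |p| := by
  have hs0 : 0 ≤ s := by linarith
  have hy0 : 0 < y := by linarith
  have ht0 : 0 < t := by linarith
  rcases le_total 0 p with hp | hp
  · calc y ^ p ≤ t ^ p := Real.rpow_le_rpow hy0.le hyt hp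
      _ ≤ t ^ p * (1 + s) ^ |p| :=
        le_mul_of_one_le_right (by positivity) (Real.one_le_rpow (by linarith) (abs_nonneg p))
  · rw [abs_of_nonpos hp]
    have h1 : t ≤ y * (1 + s) := by nlinarith
    have h2 : (y * (1 + s)) ^ p ≤ t ^ p := Real.rpow_le_rpow_of_nonpos ht0 h1 hp
    rw [Real.mul_rpow hy0.le (by linarith)] at h2
    calc y ^ p = y ^ p * (1 + s) ^ p * (1 + s) ^ (-p) := by
          rw [mul_assoc, ← Real.rpow_add (by linarith)]; simp
      _ ≤ _ := by gcongr

/-- First order Taylor expansion of `y ↦ y ^ β` at `t`. -/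
lemma abs_rpow_sub_taylor_le (β : ℝ) {t s : ℝ} (hs : 0 ≤ s) (hst : s ≤ t - 1) :
    |(t - s) ^ β - t ^ β + β * s * t ^ (β - 1)| ≤
      |β| * |β - 1| * (t ^ (β - 2) * (1 + s) ^ (|β - 2| + 2)) := by
  -- `K` bounds the second derivative of `y ^ β` on `[t - s, t]`; the mean value inequality is
  -- applied to the derivative, then to the function minus its linear part.
  set K := |β| * |β - 1| * (t ^ (β - 2) * (1 + s) ^ |β - 2|) with hK
  have ht0 : 0 < t := by linarith
  have hK0 : 0 ≤ K := by positivity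
  have hmem : ∀ y ∈ Icc (t - s) t, 1 ≤ y := fun y hy => by linarith [hy.1]
  have hd1 : ∀ y ∈ Icc (t - s) t, |β * y ^ (β - 1) - β * t ^ (β - 1)| ≤ K * s := by
    intro y hy
    have := (convex_Icc (t - s) t).norm_image_sub_le_of_norm_hasDerivWithin_le
      (f := fun y => β * y ^ (β - 1)) (f' := fun y => β * ((β - 1) * y ^ (β - 1 - 1)))
      (C := K) (x := t) (y := y) (fun x hx =>
        ((Real.hasDerivAt_rpow_const (Or.inl (by linarith [hmem x hx]))).const_mul
          β).hasDerivWithinAt)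
      (fun x hx => by
        have h1 := rpow_le_rpow_mul_one_add (p := β - 2) (hmem x hx) hx.2
          (by linarith [hx.1] : t ≤ x + s)
        have hx1 := hmem x hx
        rw [Real.norm_eq_abs, abs_mul, abs_mul, show β - 1 - 1 = β - 2 by ring,
          abs_of_nonneg (Real.rpow_nonneg (by linarith : (0 : ℝ) ≤ x) (β - 2)), hK, mul_assoc]
        gcongr) ⟨by linarith, le_rfl⟩ hy
    simp only [Real.norm_eq_abs] at this
    refine this.trans ?_
    gcongr
    rw [abs_le]
    constructor <;> linarith [hy.1, hy.2]
  have h2 := (convex_Icc (t - s) t).norm_image_sub_le_of_norm_hasDerivWithin_le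
      (f := fun y => y ^ β - β * t ^ (β - 1) * y)
      (f' := fun y => β * y ^ (β - 1) - β * t ^ (β - 1) * 1)
      (C := K * s) (x := t) (y := t - s) (fun x hx =>
        ((Real.hasDerivAt_rpow_const (Or.inl (by linarith [hmem x hx]))).sub
          ((hasDerivAt_id x).const_mul _)).hasDerivWithinAt)
      (fun x hx => by simpa using hd1 x hx) ⟨by linarith, le_rfl⟩ ⟨le_rfl, by linarith⟩
  simp only [Real.norm_eq_abs] at h2
  have h3 : |t - s - t| = s := by
    rw [show t - s - t = -s by ring, abs_neg, abs_of_nonneg hs]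
  rw [h3] at h2
  have h4 : (t - s) ^ β - t ^ β + β * s * t ^ (β - 1)
      = (t - s) ^ β - β * t ^ (β - 1) * (t - s) - (t ^ β - β * t ^ (β - 1) * t) := by ring
  rw [h4]
  refine h2.trans ?_
  have h5 : (1 + s) ^ (|β - 2| + 2) = (1 + s) ^ |β - 2| * (1 + s) ^ 2 := by
    rw [Real.rpow_add (by linarith)]; norm_num
  rw [h5]
  have h6 : s * s ≤ (1 + s) ^ 2 := by nlinarith
  calc K * s * s = K * (s * s) := by ring
    _ ≤ K * (1 + s) ^ 2 := by gcongr
    _ = _ := by rw [hK]; ring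

/-- The function `x ↦ x ^ β` on `[T, ∞)`, replaced by the constant `G` on `[0, T)` and by
`0` on `(-∞, 0)`. -/
noncomputable def cutRpow (T G β x : ℝ) : ℝ := if T ≤ x then x ^ β else if 0 ≤ x then G else 0

lemma cutRpow_of_le {T G β x : ℝ} (h : T ≤ x) : cutRpow T G β x = x ^ β := if_pos h

lemma cutRpow_of_lt {T G β x : ℝ} (h0 : 0 ≤ x) (h : x < T) : cutRpow T G β x = G := by
  simp [cutRpow, h0, h.not_ge]

lemma cutRpow_of_neg {T G β x : ℝ} (hT : 0 ≤ T) (h : x < 0) : cutRpow T G β x = 0 := by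
  simp [cutRpow, (h.trans_le hT).not_ge, h.not_ge]

lemma abs_cutRpow_le_of_lt {T G β x : ℝ} (h : x < T) : |cutRpow T G β x| ≤ |G| := by
  rw [cutRpow, if_neg h.not_ge]
  split_ifs <;> simp

lemma measurable_cutRpow (T G β : ℝ) : Measurable (cutRpow T G β) :=
  Measurable.ite measurableSet_Ici (measurable_id.pow_const β)
    (Measurable.ite measurableSet_Ici measurable_const measurable_const)

lemma abs_cutRpow_le {T G β t x : ℝ} (hT : 1 ≤ T) (ht : 1 ≤ t) (hx : x ≤ t) :
    |cutRpow T G β x| ≤ (1 + |G|) * t ^ |β| := by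
  have h1 : 1 ≤ t ^ |β| := Real.one_le_rpow ht (abs_nonneg β)
  rcases le_or_gt T x with h | h
  · have hx1 : 1 ≤ x := hT.trans h
    rw [cutRpow_of_le h, abs_of_nonneg (by positivity)]
    calc x ^ β ≤ x ^ |β| := Real.rpow_le_rpow_of_exponent_le hx1 (le_abs_self β)
      _ ≤ t ^ |β| := Real.rpow_le_rpow (by linarith) hx (abs_nonneg β)
      _ ≤ (1 + |G|) * t ^ |β| :=
        le_mul_of_one_le_left (by linarith) (by linarith [abs_nonneg G])
  · refine (abs_cutRpow_le_of_lt h).trans ?_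
    nlinarith [abs_nonneg G]

/-- Above the cut-off this is Taylor's formula. Below it, `s > t - T`, so `z ^ s` beats every power
of `t` and the three terms on the left are small separately. -/
lemma exists_cutRpow_taylor {z T : ℝ} (hz : 1 < z) (hT : 1 ≤ T) (G β : ℝ) :
    ∃ C : ℝ, 0 ≤ C ∧ ∀ t : ℝ, T ≤ t → ∀ s : ℝ, 0 ≤ s →
      |cutRpow T G β (t - s) - t ^ β + β * s * t ^ (β - 1)| ≤ C * t ^ (β - 2) * z ^ s := by
  obtain ⟨C₁, hC₁, h₁⟩ := exists_one_add_rpow_le hz (|β - 2| + 2)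
  set q := |β - 2| + 2 with hq
  have hq2 : 2 ≤ q := by linarith [abs_nonneg (β - 2)]
  set L := (|G| + 1 + |β|) * (1 + T) ^ q with hL
  have hL0 : 0 ≤ L := by positivity
  refine ⟨|β| * |β - 1| * C₁ + L * C₁, by positivity, fun t ht s hs => ?_⟩
  have ht1 : 1 ≤ t := hT.trans ht
  have ht0 : 0 < t := by linarith
  have hzs : 0 < z ^ s := Real.rpow_pos_of_pos (by linarith) s
  have htp : 0 < t ^ (β - 2) := by positivity
  rcases le_or_gt T (t - s) with h | h
  · rw [cutRpow_of_le h]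
    calc _ ≤ _ := abs_rpow_sub_taylor_le β hs (by linarith)
      _ ≤ |β| * |β - 1| * (t ^ (β - 2) * (C₁ * z ^ s)) := by gcongr; exact h₁ s hs
      _ = (|β| * |β - 1| * C₁) * (t ^ (β - 2) * z ^ s) := by ring
      _ ≤ (|β| * |β - 1| * C₁ + L * C₁) * (t ^ (β - 2) * z ^ s) := by
        gcongr
        have : 0 ≤ L * C₁ := by positivity
        linarith
      _ = _ := by ring
  · have hG := abs_cutRpow_le_of_lt (G := G) (β := β) h
    -- `m` dominates both `t` and `s`, since `t < T + s`.
    set m := (1 + T) * (1 + s) with hm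
    have hm1 : 1 ≤ m := by nlinarith
    have htm : t ≤ m := by nlinarith
    have hsm : s ≤ m := by nlinarith
    have hpow2 : m ^ (2 : ℝ) ≤ m ^ q := Real.rpow_le_rpow_of_exponent_le hm1 hq2
    rw [Real.rpow_two] at hpow2
    have e1 : t ^ β = t ^ (β - 2) * (t * t) := by
      rw [← pow_two, ← Real.rpow_two, ← Real.rpow_add ht0]; ring_nf
    have e2 : t ^ (β - 1) = t ^ (β - 2) * t := by
      nth_rewrite 3 [← Real.rpow_one t]
      rw [← Real.rpow_add ht0]; ring_nf
    have e3 : (1 : ℝ) = t ^ (β - 2) * t ^ (2 - β) := by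
      rw [← Real.rpow_add ht0]; ring_nf; simp
    have e4 : t ^ (2 - β) ≤ m ^ q :=
      calc t ^ (2 - β) ≤ t ^ q := Real.rpow_le_rpow_of_exponent_le ht1
            (by linarith [neg_le_abs (β - 2)])
        _ ≤ m ^ q := Real.rpow_le_rpow ht0.le htm (by linarith)
    have e5 : m ^ q ≤ (1 + T) ^ q * (C₁ * z ^ s) := by
      rw [hm, Real.mul_rpow (by linarith) (by linarith)]
      gcongr
      exact h₁ s hs
    have b1 : |G| ≤ |G| * (t ^ (β - 2) * m ^ q) := by
      refine le_mul_of_one_le_right (abs_nonneg G) ?_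
      calc (1 : ℝ) = t ^ (β - 2) * t ^ (2 - β) := e3
        _ ≤ _ := by gcongr
    have b2 : |t ^ β| ≤ t ^ (β - 2) * m ^ q := by
      rw [abs_of_nonneg (by positivity), e1]
      gcongr
      nlinarith
    have b3 : |β * s * t ^ (β - 1)| ≤ |β| * (t ^ (β - 2) * m ^ q) := by
      rw [abs_mul, abs_mul, abs_of_nonneg hs, abs_of_nonneg (by positivity : 0 ≤ t ^ (β - 1)), e2]
      calc |β| * s * (t ^ (β - 2) * t) = |β| * (t ^ (β - 2) * (s * t)) := by ring
        _ ≤ |β| * (t ^ (β - 2) * m ^ q) := by gcongr; nlinarith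
    calc |cutRpow T G β (t - s) - t ^ β + β * s * t ^ (β - 1)|
          ≤ |cutRpow T G β (t - s)| + |t ^ β| + |β * s * t ^ (β - 1)| :=
          (abs_add_le _ _).trans (by gcongr; exact abs_sub _ _)
      _ ≤ |G| + |t ^ β| + |β * s * t ^ (β - 1)| := by gcongr
      _ ≤ (|G| + 1 + |β|) * (t ^ (β - 2) * m ^ q) := by linarith
      _ ≤ (|G| + 1 + |β|) * (t ^ (β - 2) * ((1 + T) ^ q * (C₁ * z ^ s))) := by gcongr
      _ = (L * C₁) * (t ^ (β - 2) * z ^ s) := by rw [hL]; ring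
      _ ≤ (|β| * |β - 1| * C₁ + L * C₁) * (t ^ (β - 2) * z ^ s) := by
        gcongr
        have : 0 ≤ |β| * |β - 1| * C₁ := by positivity
        linarith
      _ = _ := by ring

/-- A function which cannot reach `0` from above for the first time stays positive. -/
lemma forall_pos_of_step {h : ℝ → ℝ} {T₁ T₂ : ℝ} (hc : ContinuousOn h (Ici T₁))
    (h0 : ∀ t ∈ Icc T₁ T₂, 0 < h t)
    (step : ∀ t, T₂ < t → (∀ u ∈ Ico T₁ t, 0 ≤ h u) → 0 < h t) :
    ∀ t, T₁ ≤ t → 0 < h t := by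
  by_contra! hcon
  obtain ⟨t₀, ht₀, hneg⟩ := hcon
  set Z := Ici T₁ ∩ h ⁻¹' Iic 0 with hZ
  have hclosed : IsClosed Z := hc.preimage_isClosed_of_isClosed isClosed_Ici isClosed_Iic
  have hbdd : BddBelow Z := ⟨T₁, fun x hx => hx.1⟩
  have hmem : sInf Z ∈ Z := hclosed.csInf_mem ⟨t₀, ht₀, hneg⟩ hbdd
  have hlt : T₂ < sInf Z := by
    by_contra! hle
    exact absurd hmem.2 (not_le.2 (h0 _ ⟨hmem.1, hle⟩))
  refine absurd hmem.2 (not_le.2 (step _ hlt fun u hu => ?_))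
  by_contra! hneg'
  exact absurd (csInf_le hbdd ⟨hu.1, hneg'.le⟩) (not_le.2 hu.2)

/-! ### Sums of sets of positive measure -/

/-- The sum of a measurable set of positive measure with itself contains an open interval. -/
lemma exists_nhds_subset_add_self {D : Set ℝ} (hD : MeasurableSet D) (h0 : volume D ≠ 0) :
    ∃ t : ℝ, ∀ᶠ u in 𝓝 t, ∃ x ∈ D, ∃ y ∈ D, u = x + y := by
  -- By Fubini, the integral over `t` of the measure of `D ∩ (t - D)` is `volume D ^ 2`, so some
  -- such intersection is not null.
  have hex : ∃ t : ℝ, volume (D ∩ (fun x => t - x) ⁻¹' D) ≠ 0 := by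
    by_contra! hcon
    set P : Set (ℝ × ℝ) := {p | p.2 ∈ D ∧ p.1 - p.2 ∈ D} with hP
    have hPm : MeasurableSet P :=
      (measurable_snd hD).inter ((measurable_fst.sub measurable_snd) hD)
    have hmp := Measure.measurePreserving_swap.comp
      (measurePreserving_prod_add_swap (volume : Measure ℝ) (volume : Measure ℝ))
    have h1 := hmp.measure_preimage hPm.nullMeasurableSet
    have h2 : (Prod.swap ∘ fun z : ℝ × ℝ => (z.2, z.2 + z.1)) ⁻¹' P = D ×ˢ D := by
      ext ⟨x, y⟩; simp [hP, and_comm]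
    rw [h2, Measure.prod_prod, (Measure.measure_prod_null hPm).2] at h1
    · exact h0 (by simpa using h1)
    · exact Eventually.of_forall hcon
  obtain ⟨t, ht⟩ := hex
  refine ⟨t, ?_⟩
  have hF : MeasurableSet (D ∩ (fun x => t - x) ⁻¹' D) :=
    hD.inter ((measurable_const.sub measurable_id) hD)
  -- Steinhaus for `F = D ∩ (t - D)`: a difference `x - y` of points of `F` gives `t + (x - y) = x +
  -- (t - y)`, a sum of two points of `D`.
  have hnhds := Measure.sub_mem_nhds_zero_of_addHaar_pos volume _ hF (pos_iff_ne_zero.2 ht)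
  have htend : Tendsto (fun u : ℝ => u - t) (𝓝 t) (𝓝 0) := by
    have : Continuous fun u : ℝ => u - t := by fun_prop
    simpa using this.tendsto t
  filter_upwards [htend hnhds] with u hu
  obtain ⟨x, hx, y, hy, hxy⟩ := hu
  exact ⟨x, hx.1, t - y, hy.2, by simp only at hxy; linarith⟩

/-- An open interval of positive translations under which a set of reals is stable sweeps out a
half-line from any point of the set. -/
lemma eventually_mem_of_add_stable {S : Set ℝ} {α β t₀ : ℝ} (hα : 0 ≤ α) (hαβ : α < β)
    (ht₀ : t₀ ∈ S) (hS : ∀ t ∈ S, ∀ u ∈ Ioo α β, t + u ∈ S) : ∀ᶠ t in atTop, t ∈ S := by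
  have hmul : ∀ (k : ℕ), ∀ u ∈ Ioo α β, t₀ + k * u ∈ S := by
    intro k u hu
    induction k with
    | zero => simpa using ht₀
    | succ k ih =>
      have := hS _ ih u hu
      push_cast
      rwa [show t₀ + (k + 1 : ℝ) * u = t₀ + k * u + u by ring]
  set v := (α + β) / 2 with hv
  have hv0 : 0 < v := by linarith
  have hlim : Tendsto (fun t : ℝ => (t - t₀) / v) atTop atTop :=
    (tendsto_atTop_add_const_right _ (-t₀) tendsto_id).atTop_div_const hv0
  filter_upwards [hlim.eventually_gt_atTop (β / (v - α) + 1), eventually_ge_atTop t₀] with t ht htt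
  -- The step `(t - t₀) / k` is at least `v` and exceeds it by less than `v / k`, so it stays in
  -- `(α, β)` for large `k`.
  set k := ⌊(t - t₀) / v⌋₊ with hk
  have hva : 0 < v - α := by linarith
  have hb0 : 0 < β / (v - α) := div_pos (by linarith) hva
  have h1 : (k : ℝ) ≤ (t - t₀) / v := Nat.floor_le (by linarith)
  have h2 : (t - t₀) / v < k + 1 := Nat.lt_floor_add_one _
  have hk1 : β / (v - α) < k := by linarith
  have hk0 : (0 : ℝ) < k := hb0.trans hk1
  rw [le_div_iff₀ hv0] at h1
  rw [div_lt_iff₀ hv0] at h2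
  rw [div_lt_iff₀ hva] at hk1
  have := hmul k ((t - t₀) / k) ⟨by rw [lt_div_iff₀ hk0]; nlinarith,
    by rw [div_lt_iff₀ hk0]; nlinarith⟩
  rwa [mul_div_cancel₀ _ hk0.ne', add_sub_cancel] at this

/-! ### Consequences of the conditions -/

/-- For `τ = 1` each block supremum is a term of the convergent series. The blocks start at `1`,
whence `1 ≤ t`. -/
lemma NonnegDRI.exists_bound {h : ℝ → ℝ} (hh : NonnegDRI h) :
    ∃ C : ℝ, 0 ≤ C ∧ ∀ t : ℝ, 1 ≤ t → h t ≤ C := by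
  have hsum := hh.2 1 one_pos
  set M := ∑' n : ℕ, ⨆ θ ∈ Icc (((n : ℝ) + 1) * 1) (((n : ℝ) + 2) * 1), ENNReal.ofReal (h θ)
  refine ⟨M.toReal, ENNReal.toReal_nonneg, fun t ht => ?_⟩
  rw [← ENNReal.ofReal_le_iff_le_toReal hsum.ne]
  have hfl : (⌊t - 1⌋₊ : ℝ) ≤ t - 1 := Nat.floor_le (by linarith)
  have hfl' : t - 1 < ⌊t - 1⌋₊ + 1 := Nat.lt_floor_add_one _
  refine le_trans ?_ (ENNReal.le_tsum ⌊t - 1⌋₊)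
  exact le_iSup₂ (f := fun θ _ => ENNReal.ofReal (h θ)) t ⟨by linarith, by linarith⟩

lemma DirectlyRiemannIntegrable.exists_bound {h : ℝ → ℝ} (hh : DirectlyRiemannIntegrable h) :
    ∃ C : ℝ, 0 ≤ C ∧ ∀ t : ℝ, 1 ≤ t → h t ≤ C := by
  obtain ⟨C, hC, h1⟩ := hh.1.exists_bound
  exact ⟨C, hC, fun t ht => (le_max_left _ _).trans (h1 t ht)⟩

lemma integrableOn_id_mul {p : ℝ → ℝ} {z : ℝ} (hz : 1 < z) (hp : IntegrableOn p (Ioi 0))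
    (hpz : IntegrableOn (fun s => |p s| * z ^ s) (Ioi 0)) :
    IntegrableOn (fun s => s * p s) (Ioi 0) := by
  obtain ⟨C, hC, h⟩ := exists_one_add_rpow_le hz 1
  refine Integrable.mono' (hpz.const_mul C)
    (aestronglyMeasurable_id.mul hp.aestronglyMeasurable) ?_
  filter_upwards [ae_restrict_mem measurableSet_Ioi] with s hs
  have hs0 : 0 < s := hs
  have h1 := h s hs0.le
  rw [Real.rpow_one] at h1
  rw [Real.norm_eq_abs, abs_mul, abs_of_pos hs0]
  nlinarith [abs_nonneg (p s)]

/-- Expansion of the convolution of `p` with a cut-off power. -/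
lemma exists_convolution_bound {p : ℝ → ℝ} {z T : ℝ} (hz : 1 < z) (hT : 1 ≤ T)
    (hp : IntegrableOn p (Ioi 0)) (hpz : IntegrableOn (fun s => |p s| * z ^ s) (Ioi 0))
    (G β : ℝ) :
    ∃ C : ℝ, 0 ≤ C ∧ ∀ t : ℝ, T ≤ t →
      |(∫ s in (0 : ℝ)..t, p s * cutRpow T G β (t - s)) - t ^ β * (∫ s in Ioi (0 : ℝ), p s)
        + β * t ^ (β - 1) * ∫ s in Ioi (0 : ℝ), s * p s| ≤ C * t ^ (β - 2) := by
  obtain ⟨C, hC, h⟩ := exists_cutRpow_taylor hz hT G β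
  have hz0 : 0 < z := by linarith
  have hM : 0 ≤ ∫ s in Ioi (0 : ℝ), |p s| * z ^ s :=
    setIntegral_nonneg measurableSet_Ioi fun s _ => by positivity
  refine ⟨C * ∫ s in Ioi (0 : ℝ), |p s| * z ^ s, by positivity, fun t ht => ?_⟩
  have ht0 : 0 < t := by linarith
  have hsp := integrableOn_id_mul hz hp hpz
  set e := fun s => cutRpow T G β (t - s) - t ^ β + β * s * t ^ (β - 1) with he
  have hem : Measurable e :=
    (((measurable_cutRpow T G β).comp (measurable_const.sub measurable_id)).sub_const _).add
      (by fun_prop)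
  have hbound : ∀ᵐ s ∂volume.restrict (Ioi (0 : ℝ)),
      ‖p s * e s‖ ≤ C * t ^ (β - 2) * (|p s| * z ^ s) := by
    filter_upwards [ae_restrict_mem measurableSet_Ioi] with s hs
    rw [Real.norm_eq_abs, abs_mul]
    have := h t ht s (le_of_lt hs)
    calc |p s| * |e s| ≤ |p s| * (C * t ^ (β - 2) * z ^ s) := by gcongr
      _ = _ := by ring
  have hpe : IntegrableOn (fun s => p s * e s) (Ioi 0) :=
    (hpz.const_mul _).mono' (hp.aestronglyMeasurable.mul hem.aestronglyMeasurable) hbound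
  -- The cut-off power vanishes at negative arguments, so full moments appear instead of truncated
  -- ones.
  have h1 : ∫ s in (0 : ℝ)..t, p s * cutRpow T G β (t - s)
      = ∫ s in Ioi (0 : ℝ), p s * cutRpow T G β (t - s) := by
    rw [intervalIntegral.integral_of_le ht0.le]
    refine (setIntegral_eq_of_subset_of_forall_sdiff_eq_zero measurableSet_Ioi
      Ioc_subset_Ioi_self fun s hs => ?_).symm
    have : t < s := by
      by_contra! hle
      exact hs.2 ⟨hs.1, hle⟩
    rw [cutRpow_of_neg (by linarith) (by linarith), mul_zero]
  have h2 : ∫ s in Ioi (0 : ℝ), p s * cutRpow T G β (t - s)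
      = (∫ s in Ioi (0 : ℝ), p s * e s) + t ^ β * (∫ s in Ioi (0 : ℝ), p s)
        - β * t ^ (β - 1) * ∫ s in Ioi (0 : ℝ), s * p s := by
    rw [← integral_const_mul, ← integral_const_mul, ← integral_add hpe (hp.const_mul _),
      ← integral_sub (f := fun s => p s * e s + t ^ β * p s) (hpe.add (hp.const_mul _))
        (hsp.const_mul _)]
    refine integral_congr_ae (Eventually.of_forall fun s => ?_)
    simp only [he]
    ring
  rw [h1, h2]
  have h3 := norm_integral_le_of_norm_le (hpz.const_mul (C * t ^ (β - 2))) hbound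
  rw [integral_const_mul, Real.norm_eq_abs] at h3
  calc _ = |∫ s in Ioi (0 : ℝ), p s * e s| := by congr 1; ring
    _ ≤ _ := h3
    _ = _ := by ring

variable {a b : ℝ → ℝ} {c : ℝ → ℝ → ℝ} {r g : ℝ → ℝ} {d : ℝ}

lemma Conditions.kernel_intervalIntegrable (hc : Conditions a b c r d) {t : ℝ} (ht : 0 < t) :
    IntervalIntegrable (kernel a b c d t) volume 0 t := by
  have ha : IntervalIntegrable a volume 0 t :=
    (intervalIntegrable_iff_integrableOn_Ioc_of_le ht.le).2
      (hc.a_integrable.mono_set Ioc_subset_Ioi_self)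
  have hb : IntervalIntegrable b volume 0 t :=
    (intervalIntegrable_iff_integrableOn_Ioc_of_le ht.le).2
      (hc.b_integrable.mono_set Ioc_subset_Ioi_self)
  exact (ha.add (hb.div_const (t + d))).add (hc.c_integrable t ht)

lemma intervalIntegrable_mul_cutRpow {w : ℝ → ℝ} {T t : ℝ} (hT : 1 ≤ T) (ht : T ≤ t) (G β : ℝ)
    (hw : IntervalIntegrable w volume 0 t) :
    IntervalIntegrable (fun s => w s * cutRpow T G β (t - s)) volume 0 t := by
  have ht0 : 0 ≤ t := by linarith
  rw [intervalIntegrable_iff_integrableOn_Ioc_of_le ht0] at hw ⊢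
  refine Integrable.mul_bdd (c := (1 + |G|) * t ^ |β|) hw
    ((measurable_cutRpow T G β).comp (measurable_const.sub measurable_id)).aestronglyMeasurable ?_
  filter_upwards [ae_restrict_mem measurableSet_Ioc] with s hs
  exact abs_cutRpow_le hT (by linarith) (by linarith [hs.1])

/-- The part `a` gives `t ^ β - β A t ^ (β - 1)`, and `b / (t + d)` gives `B t ^ (β - 1)`, the shift
by `d` costing only `O(t ^ (β - 2))`. The part `c` has exponentially small mass, against polynomial
growth of the cut-off power. -/
lemma Conditions.exists_kernel_expansion (hc : Conditions a b c r d) {T : ℝ} (hT : 1 ≤ T)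
    (G β : ℝ) :
    ∃ C : ℝ, 0 ≤ C ∧ ∀ t : ℝ, T ≤ t →
      |(∫ s in (0 : ℝ)..t, kernel a b c d t s * cutRpow T G β (t - s)) - t ^ β
        - ((∫ s in Ioi (0 : ℝ), b s) - β * ∫ s in Ioi (0 : ℝ), s * a s) * t ^ (β - 1)|
        ≤ C * t ^ (β - 2) := by
  obtain ⟨z, hz, haz, hbz, hcz, -⟩ := hc.exp_moments
  have hz0 : 0 < z := by linarith
  have haz' : IntegrableOn (fun s => |a s| * z ^ s) (Ioi 0) := by
    refine haz.congr ?_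
    filter_upwards [hc.a_nonneg] with s hs
    rw [abs_of_nonneg hs]
  obtain ⟨Ca, hCa, ha⟩ := exists_convolution_bound hz hT hc.a_integrable haz' G β
  obtain ⟨Cb, hCb, hb⟩ := exists_convolution_bound hz hT hc.b_integrable hbz G β
  obtain ⟨Cc, hCc, hcb⟩ := hcz.exists_bound
  obtain ⟨Cz, hCz, hzb⟩ := exists_rpow_mul_le hz (β - 2 - |β|)
  set A := ∫ s in Ioi (0 : ℝ), s * a s
  set B := ∫ s in Ioi (0 : ℝ), b s
  set B₁ := ∫ s in Ioi (0 : ℝ), s * b s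
  refine ⟨Ca + (Cb + |B| * d + |β * B₁|) + (1 + |G|) * Cc * Cz,
    by have := hc.d_pos; positivity, fun t ht => ?_⟩
  have hd := hc.d_pos
  have ht1 : 1 ≤ t := hT.trans ht
  have ht0 : 0 < t := by linarith
  have hai : IntervalIntegrable a volume 0 t :=
    (intervalIntegrable_iff_integrableOn_Ioc_of_le ht0.le).2
      (hc.a_integrable.mono_set Ioc_subset_Ioi_self)
  have hbi : IntervalIntegrable b volume 0 t :=
    (intervalIntegrable_iff_integrableOn_Ioc_of_le ht0.le).2
      (hc.b_integrable.mono_set Ioc_subset_Ioi_self)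
  have hci := hc.c_integrable t ht0
  have hai' := intervalIntegrable_mul_cutRpow hT ht G β hai
  have hbi' := intervalIntegrable_mul_cutRpow hT ht G β hbi
  have hci' := intervalIntegrable_mul_cutRpow hT ht G β hci
  have hsplit : ∫ s in (0 : ℝ)..t, kernel a b c d t s * cutRpow T G β (t - s)
      = (∫ s in (0 : ℝ)..t, a s * cutRpow T G β (t - s))
        + (∫ s in (0 : ℝ)..t, b s * cutRpow T G β (t - s)) / (t + d)
        + ∫ s in (0 : ℝ)..t, c t s * cutRpow T G β (t - s) := by
    rw [← intervalIntegral.integral_div, ← intervalIntegral.integral_add hai' (hbi'.div_const _),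
      ← intervalIntegral.integral_add (hai'.add (hbi'.div_const _)) hci']
    refine intervalIntegral.integral_congr fun s _ => ?_
    simp only [kernel]
    ring
  set Ia := ∫ s in (0 : ℝ)..t, a s * cutRpow T G β (t - s)
  set Ib := ∫ s in (0 : ℝ)..t, b s * cutRpow T G β (t - s)
  set Ic := ∫ s in (0 : ℝ)..t, c t s * cutRpow T G β (t - s)
  have e1 : t ^ β = t ^ (β - 1) * t := by
    nth_rewrite 3 [← Real.rpow_one t]
    rw [← Real.rpow_add ht0]; ring_nf
  have e2 : t ^ (β - 1) = t ^ (β - 2) * t := by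
    nth_rewrite 3 [← Real.rpow_one t]
    rw [← Real.rpow_add ht0]; ring_nf
  have hp2 : 0 < t ^ (β - 2) := by positivity
  have hIa : |Ia - t ^ β + β * A * t ^ (β - 1)| ≤ Ca * t ^ (β - 2) := by
    have := ha t ht
    rw [hc.a_integral] at this
    convert this using 2
    ring
  have hIb : |Ib / (t + d) - B * t ^ (β - 1)| ≤ (Cb + |B| * d + |β * B₁|) * t ^ (β - 2) := by
    have h1 := hb t ht
    have h2 : Ib / (t + d) - B * t ^ (β - 1)
        = ((Ib - t ^ β * B + β * t ^ (β - 1) * B₁) - B * d * t ^ (β - 1)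
          - β * B₁ * t ^ (β - 1)) / (t + d) := by
      rw [e1]
      field_simp
      ring
    rw [h2, abs_div, abs_of_pos (by linarith : 0 < t + d), div_le_iff₀ (by linarith)]
    have h3 : |B * d * t ^ (β - 1)| = |B| * d * (t ^ (β - 2) * t) := by
      rw [abs_mul, abs_mul, abs_of_pos hd, ← e2, abs_of_pos (by positivity : 0 < t ^ (β - 1))]
    have h4 : |β * B₁ * t ^ (β - 1)| = |β * B₁| * (t ^ (β - 2) * t) := by
      rw [abs_mul, ← e2, abs_of_pos (by positivity : 0 < t ^ (β - 1))]
    calc _ ≤ |Ib - t ^ β * B + β * t ^ (β - 1) * B₁| + |B * d * t ^ (β - 1)|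
          + |β * B₁ * t ^ (β - 1)| := (abs_sub _ _).trans (by gcongr; exact abs_sub _ _)
      _ ≤ Cb * t ^ (β - 2) * (t + d) + |B| * d * (t ^ (β - 2) * (t + d))
          + |β * B₁| * (t ^ (β - 2) * (t + d)) := by
        rw [h3, h4]
        gcongr
        · exact h1.trans (le_mul_of_one_le_right (by positivity) (by linarith))
        · linarith
        · linarith
      _ = _ := by ring
  have hIc : |Ic| ≤ (1 + |G|) * Cc * Cz * t ^ (β - 2) := by
    have h1 : |Ic| ≤ ∫ s in (0 : ℝ)..t, |c t s| * ((1 + |G|) * t ^ |β|) := by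
      rw [← Real.norm_eq_abs]
      refine intervalIntegral.norm_integral_le_of_norm_le ht0.le
        (Eventually.of_forall fun s hs => ?_) (hci.abs.mul_const _)
      rw [Real.norm_eq_abs, abs_mul]
      gcongr
      exact abs_cutRpow_le hT ht1 (by linarith [hs.1])
    rw [intervalIntegral.integral_mul_const] at h1
    have h2 := hcb t ht1
    have h3 := hzb t ht1
    have h4 : ∫ s in (0 : ℝ)..t, |c t s| ≤ Cc * (Cz * t ^ (β - 2 - |β|)) := by
      calc ∫ s in (0 : ℝ)..t, |c t s| = (z ^ t * ∫ s in (0 : ℝ)..t, |c t s|) * z ^ (-t) := by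
            rw [mul_right_comm, ← Real.rpow_add hz0]; simp
        _ ≤ Cc * (Cz * t ^ (β - 2 - |β|)) := by gcongr
    calc |Ic| ≤ _ := h1
      _ ≤ Cc * (Cz * t ^ (β - 2 - |β|)) * ((1 + |G|) * t ^ |β|) := by gcongr
      _ = (1 + |G|) * Cc * Cz * (t ^ (β - 2 - |β|) * t ^ |β|) := by ring
      _ = _ := by rw [← Real.rpow_add ht0]; ring_nf
  rw [hsplit]
  calc _ = |(Ia - t ^ β + β * A * t ^ (β - 1)) + (Ib / (t + d) - B * t ^ (β - 1)) + Ic| := by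
        congr 1; ring
    _ ≤ |Ia - t ^ β + β * A * t ^ (β - 1)| + |Ib / (t + d) - B * t ^ (β - 1)| + |Ic| :=
        abs_add_three _ _ _
    _ ≤ _ := by linarith

/-- A zero moment would force `a = 0` almost everywhere, against `∫ a = 1`. -/
lemma Conditions.first_moment_pos (hc : Conditions a b c r d) :
    0 < ∫ s in Ioi (0 : ℝ), s * a s := by
  obtain ⟨z, hz, haz, -⟩ := hc.exp_moments
  have haz' : IntegrableOn (fun s => |a s| * z ^ s) (Ioi 0) := by
    refine haz.congr ?_
    filter_upwards [hc.a_nonneg] with s hs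
    rw [abs_of_nonneg hs]
  have hnn : 0 ≤ᵐ[volume.restrict (Ioi (0 : ℝ))] fun s => s * a s := by
    filter_upwards [hc.a_nonneg, ae_restrict_mem measurableSet_Ioi] with s hs hs0
    exact mul_nonneg (le_of_lt hs0) hs
  refine lt_of_le_of_ne (integral_nonneg_of_ae hnn) fun h0 => ?_
  have h1 := (integral_eq_zero_iff_of_nonneg_ae hnn
    (integrableOn_id_mul hz hc.a_integrable haz')).1 h0.symm
  have h2 : ∫ s in Ioi (0 : ℝ), a s = 0 := by
    refine integral_eq_zero_of_ae ?_
    filter_upwards [h1, ae_restrict_mem measurableSet_Ioi] with s hs hs0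
    exact (mul_eq_zero.1 hs).resolve_left (ne_of_gt hs0)
  linarith [hc.a_integral]

/-- The test function `t ^ γ + κ t ^ (γ - 1/2)` is a strict sub- or supersolution near infinity,
according to the sign of `κ`. -/
lemma Conditions.exists_testFunction_expansion (hc : Conditions a b c r d) {T : ℝ} (hT : 1 ≤ T)
    (G κ : ℝ) {γ : ℝ} (hγ : γ = exponent a b) :
    ∃ C : ℝ, 0 ≤ C ∧ ∀ t : ℝ, T ≤ t →
      |(∫ s in (0 : ℝ)..t, kernel a b c d t s *
          (cutRpow T G γ (t - s) + κ * cutRpow T 0 (γ - 1 / 2) (t - s)))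
        - (t ^ γ + κ * t ^ (γ - 1 / 2))
        - κ * ((∫ s in Ioi (0 : ℝ), s * a s) / 2) * t ^ (γ - 3 / 2)| ≤ C * t ^ (γ - 2) := by
  obtain ⟨C₁, hC₁, h₁⟩ := hc.exists_kernel_expansion hT G γ
  obtain ⟨C₂, hC₂, h₂⟩ := hc.exists_kernel_expansion hT 0 (γ - 1 / 2)
  have hA := hc.first_moment_pos
  set A := ∫ s in Ioi (0 : ℝ), s * a s
  have hB : ∫ s in Ioi (0 : ℝ), b s = γ * A := by
    rw [hγ, exponent, div_mul_cancel₀ _ hA.ne']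
  refine ⟨C₁ + |κ| * C₂, by positivity, fun t ht => ?_⟩
  have ht1 : 1 ≤ t := hT.trans ht
  have ht0 : 0 < t := by linarith
  have hi := hc.kernel_intervalIntegrable ht0
  have hi1 := intervalIntegrable_mul_cutRpow hT ht G γ hi
  have hi2 := intervalIntegrable_mul_cutRpow hT ht 0 (γ - 1 / 2) hi
  have hsplit : ∫ s in (0 : ℝ)..t, kernel a b c d t s *
          (cutRpow T G γ (t - s) + κ * cutRpow T 0 (γ - 1 / 2) (t - s))
      = (∫ s in (0 : ℝ)..t, kernel a b c d t s * cutRpow T G γ (t - s))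
        + κ * ∫ s in (0 : ℝ)..t, kernel a b c d t s * cutRpow T 0 (γ - 1 / 2) (t - s) := by
    rw [← intervalIntegral.integral_const_mul,
      ← intervalIntegral.integral_add hi1 (hi2.const_mul κ)]
    refine intervalIntegral.integral_congr fun s _ => ?_
    ring
  have e1 := h₁ t ht
  have e2 := h₂ t ht
  rw [hsplit]
  rw [hB] at e1 e2
  rw [show γ - 1 / 2 - 1 = γ - 3 / 2 by ring] at e2
  have e3 : t ^ (γ - 1 / 2 - 2) ≤ t ^ (γ - 2) :=
    Real.rpow_le_rpow_of_exponent_le ht1 (by linarith)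
  set I₁ := ∫ s in (0 : ℝ)..t, kernel a b c d t s * cutRpow T G γ (t - s)
  set I₂ := ∫ s in (0 : ℝ)..t, kernel a b c d t s * cutRpow T 0 (γ - 1 / 2) (t - s)
  calc _ = |(I₁ - t ^ γ - (γ * A - γ * A) * t ^ (γ - 1))
        + κ * (I₂ - t ^ (γ - 1 / 2) - (γ * A - (γ - 1 / 2) * A) * t ^ (γ - 3 / 2))| := by
        congr 1; ring
    _ ≤ C₁ * t ^ (γ - 2) + |κ| * (C₂ * t ^ (γ - 2)) := by
        refine (abs_add_le _ _).trans ?_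
        rw [abs_mul]
        gcongr
        exact e2.trans (by gcongr)
    _ = _ := by ring

/-! ### Solutions of the equation -/

lemma IsSolution.exists_bound {w : ℝ → ℝ → ℝ} (hg : IsSolution w r g) (T : ℝ) :
    ∃ G : ℝ, 0 ≤ G ∧ ∀ t ∈ Icc 0 T, g t ≤ G := by
  obtain ⟨G₁, h₁⟩ := hg.bounded
  have hc : ContinuousOn g (Icc 1 T) :=
    hg.continuousOn.mono fun x hx => lt_of_lt_of_le one_pos hx.1
  obtain ⟨G₂, h₂⟩ := isCompact_Icc.bddAbove_image hc
  refine ⟨max (max G₁ G₂) 0, le_max_right _ _, fun t ht => ?_⟩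
  rcases le_total t 1 with h | h
  · exact (h₁ (mem_image_of_mem g ⟨ht.1, h⟩)).trans ((le_max_left _ _).trans (le_max_left _ _))
  · exact (h₂ (mem_image_of_mem g ⟨h, ht.2⟩)).trans ((le_max_right _ _).trans (le_max_left _ _))

lemma IsSolution.intervalIntegrable_mul {w : ℝ → ℝ → ℝ} (hg : IsSolution w r g) {t : ℝ}
    (ht : 0 < t) {v : ℝ → ℝ} (hv : IntervalIntegrable v volume 0 t) :
    IntervalIntegrable (fun s => v s * g (t - s)) volume 0 t := by
  obtain ⟨G, hG, h⟩ := hg.exists_bound t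
  -- The open interval avoids `s = t`, where `g (t - s)` may jump.
  rw [intervalIntegrable_iff_integrableOn_Ioo_of_le ht.le] at hv ⊢
  refine Integrable.mul_bdd (c := G) hv ?_ ?_
  · refine ContinuousOn.aestronglyMeasurable ?_ measurableSet_Ioo
    exact hg.continuousOn.comp (by fun_prop) fun s hs => by
      simpa using hs.2
  · filter_upwards [ae_restrict_mem measurableSet_Ioo] with s hs
    rw [Real.norm_eq_abs, abs_of_nonneg (hg.nonneg _ (by linarith [hs.2]))]
    exact h _ ⟨by linarith [hs.2], by linarith [hs.1]⟩

/-- For large `t` the kernel is positive on a fixed set of positive outer measure. -/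
lemma Conditions.exists_kernel_pos (hc : Conditions a b c r d) :
    ∃ N : ℕ, volume {s : ℝ | 0 < s ∧ ∀ t : ℝ, (N : ℝ) ≤ t → 0 < kernel a b c d t s} ≠ 0 := by
  by_contra! hcon
  set E : ℕ → Set ℝ := fun N => {s : ℝ | 0 < s ∧ ∀ t : ℝ, (N : ℝ) ≤ t → 0 < kernel a b c d t s}
  have hU : volume (⋃ N, E N) = 0 := measure_iUnion_null hcon
  have hae : ∀ᵐ s ∂volume.restrict (Ioi (0 : ℝ)), s ∉ ⋃ N, E N :=
    ae_restrict_of_ae (measure_eq_zero_iff_ae_notMem.1 hU)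
  -- The kernel tends to `a s` for almost every `s`, so almost every `s` with `a s > 0` lies in some
  -- `E N`.
  have h0 : ∫ s in Ioi (0 : ℝ), a s = 0 := by
    refine integral_eq_zero_of_ae ?_
    filter_upwards [hae, hc.a_nonneg, hc.c_tendsto, ae_restrict_mem measurableSet_Ioi]
      with s hs ha hct hs0
    by_contra hne
    have hpos : 0 < a s := lt_of_le_of_ne ha (Ne.symm hne)
    have hlim : Tendsto (fun t => kernel a b c d t s) atTop (𝓝 (a s + 0 + 0)) :=
      (tendsto_const_nhds.add (Tendsto.const_div_atTop
        (tendsto_atTop_add_const_right _ d tendsto_id) (b s))).add hct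
    have hev := hlim.eventually (lt_mem_nhds (by linarith : 0 < a s + 0 + 0))
    obtain ⟨t₀, ht₀⟩ := eventually_atTop.1 hev
    obtain ⟨N, hN⟩ := exists_nat_ge t₀
    exact hs (mem_iUnion.2 ⟨N, hs0, fun t ht => ht₀ t (hN.trans ht)⟩)
  linarith [hc.a_integral]

/-- A solution which is not eventually zero is eventually positive. -/
lemma IsSolution.eventually_pos (hc : Conditions a b c r d)
    (hw : ∀ t, 0 < t → ∀ᵐ s ∂volume.restrict (Ioc (0 : ℝ) t), 0 ≤ kernel a b c d t s)
    (hg : IsSolution (kernel a b c d) r g) (hpos : ∀ T : ℝ, 0 < T → ∃ t, T < t ∧ 0 < g t) :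
    ∀ᶠ t in atTop, 0 < g t := by
  obtain ⟨N, hN⟩ := hc.exists_kernel_pos
  set E : Set ℝ := {s : ℝ | 0 < s ∧ ∀ t : ℝ, (N : ℝ) ≤ t → 0 < kernel a b c d t s} with hE
  set ν := (volume : Measure ℝ).restrict E with hν
  -- Measurability of `E` is not established; the closed set `D` replaces it, each neighbourhood of
  -- its points meeting `E` in positive outer measure.
  set D := ν.support with hD
  have hDm : MeasurableSet D := Measure.isClosed_support.measurableSet
  have hD0 : volume D ≠ 0 := by
    intro h0
    have h1 : ν D = 0 := Measure.restrict_le_self.absolutelyContinuous h0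
    have h2 : ν univ = 0 := by
      rw [← union_compl_self D]
      exact measure_union_null h1 Measure.measure_compl_support
    rw [hν, Measure.restrict_apply_univ] at h2
    exact hN h2
  have hDnhds : ∀ x ∈ D, ∀ V : Set ℝ, IsOpen V → x ∈ V → 0 < volume (V ∩ E) := by
    intro x hx V hV hxV
    have := (Measure.mem_support_iff_forall x).1 hx V (hV.mem_nhds hxV)
    rwa [hν, Measure.restrict_apply hV.measurableSet] at this
  have hDnn : ∀ x ∈ D, 0 ≤ x := by
    intro x hx
    by_contra! hneg
    have := hDnhds x hx (Iio 0) isOpen_Iio hneg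
    rw [show Iio (0 : ℝ) ∩ E = ∅ by
      ext s
      simp only [mem_inter_iff, mem_Iio, mem_empty_iff_false, iff_false, not_and]
      exact fun h1 h2 => absurd h2.1 (not_lt.2 h1.le)] at this
    simp at this
  set S : Set ℝ := {t | (N : ℝ) < t ∧ 0 < g t} with hS
  have hUo : IsOpen (Ioi (0 : ℝ) ∩ g ⁻¹' Ioi 0) :=
    hg.continuousOn.isOpen_inter_preimage isOpen_Ioi isOpen_Ioi
  -- Near `s = x`, continuity gives `g (t + x - s) > 0`, and the kernel is positive on `E`, so the
  -- integral at time `t + x` is positive.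
  have hSD : ∀ t ∈ S, ∀ x ∈ D, t + x ∈ S := by
    intro t ht x hx
    have hN0 : (0 : ℝ) ≤ N := N.cast_nonneg
    have hx0 := hDnn x hx
    have hτN : (N : ℝ) < t + x := by linarith [ht.1]
    have hτ0 : 0 < t + x := by linarith
    refine ⟨hτN, ?_⟩
    have hVo : IsOpen ((fun s => t + x - s) ⁻¹' (Ioi (0 : ℝ) ∩ g ⁻¹' Ioi 0)) :=
      hUo.preimage (by fun_prop)
    have hvol := hDnhds x hx _ hVo (by
      simp only [mem_preimage, add_sub_cancel_right]
      exact ⟨lt_of_le_of_lt hN0 ht.1, ht.2⟩)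
    have hint := hg.intervalIntegrable_mul hτ0 (hc.kernel_intervalIntegrable hτ0)
    have hnn : 0 ≤ᵐ[volume.restrict (Ioc 0 (t + x))]
        fun s => kernel a b c d (t + x) s * g (t + x - s) := by
      filter_upwards [hw _ hτ0, ae_restrict_mem measurableSet_Ioc] with s hs hs'
      exact mul_nonneg hs (hg.nonneg _ (by linarith [hs'.2]))
    have hipos : 0 < ∫ s in (0 : ℝ)..(t + x), kernel a b c d (t + x) s * g (t + x - s) := by
      rw [intervalIntegral.integral_of_le hτ0.le]
      rw [intervalIntegrable_iff_integrableOn_Ioc_of_le hτ0.le] at hint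
      rw [setIntegral_pos_iff_support_of_nonneg_ae hnn hint]
      refine hvol.trans_le (measure_mono ?_)
      rintro s ⟨⟨hs1, hs2⟩, hs3, hs4⟩
      simp only [mem_Ioi, mem_preimage] at hs1 hs2
      exact ⟨(mul_pos (hs4 _ hτN.le) hs2).ne', hs3, by linarith⟩
    rw [hg.equation _ hτ0]
    linarith [hc.r_nonneg _ hτ0.le]
  obtain ⟨t₁, ht₁⟩ := exists_nhds_subset_add_self hDm hD0
  have ht₁0 : 0 ≤ t₁ := by
    obtain ⟨x, hx, y, hy, hxy⟩ := ht₁.self_of_nhds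
    linarith [hDnn x hx, hDnn y hy]
  obtain ⟨l, u, hlu, hsub⟩ := mem_nhds_iff_exists_Ioo_subset.1 ht₁
  obtain ⟨t₀, ht₀, hgt₀⟩ := hpos (N + 1) (by positivity)
  have := eventually_mem_of_add_stable (S := S) (α := max l 0) (β := u) (t₀ := t₀)
    (le_max_right _ _) (max_lt (hlu.1.trans hlu.2) (ht₁0.trans_lt hlu.2)) ⟨by linarith, hgt₀⟩
    (fun t ht v hv => by
      obtain ⟨x, hx, y, hy, hxy⟩ := hsub ⟨(le_max_left _ _).trans_lt hv.1, hv.2⟩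
      rw [hxy, ← add_assoc]
      exact hSD _ (hSD t ht x hx) y hy)
  exact this.mono fun t ht => ht.2

lemma exists_mul_rpow_lt {A : ℝ} (hA : 0 < A) (C γ : ℝ) :
    ∃ T : ℝ, ∀ t : ℝ, T < t → C * t ^ (γ - 2) < A * t ^ (γ - 3 / 2) := by
  have hlim : Tendsto (fun t : ℝ => t ^ (1 / 2 : ℝ)) atTop atTop :=
    tendsto_rpow_atTop (by norm_num)
  obtain ⟨T, hT⟩ := eventually_atTop.1 (hlim.eventually_gt_atTop (C / A))
  refine ⟨max T 0, fun t ht => ?_⟩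
  have ht0 : 0 < t := (le_max_right _ _).trans_lt ht
  have h1 := hT t ((le_max_left _ _).trans ht.le)
  rw [div_lt_iff₀ hA] at h1
  have h2 : t ^ (γ - 3 / 2) = t ^ (γ - 2) * t ^ (1 / 2 : ℝ) := by
    rw [← Real.rpow_add ht0]; ring_nf
  rw [h2]
  have h3 : 0 < t ^ (γ - 2) := by positivity
  nlinarith

lemma continuousOn_testFunction {T : ℝ} (hT : 0 < T) (γ κ : ℝ) :
    ContinuousOn (fun t : ℝ => t ^ γ + κ * t ^ (γ - 1 / 2)) (Ici T) := by
  have hne : ∀ t ∈ Ici T, t ≠ 0 ∨ 0 ≤ γ := fun t ht => Or.inl (hT.trans_le ht).ne'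
  have hne' : ∀ t ∈ Ici T, t ≠ 0 ∨ 0 ≤ γ - 1 / 2 := fun t ht => Or.inl (hT.trans_le ht).ne'
  exact (continuousOn_id.rpow_const hne).add
    (continuousOn_const.mul (continuousOn_id.rpow_const hne'))

/-- Upper bound: comparison with the supersolution `t ^ γ - t ^ (γ - 1/2)`. -/
lemma IsSolution.exists_le_mul_rpow (hc : Conditions a b c r d)
    (hw : ∀ t, 0 < t → ∀ᵐ s ∂volume.restrict (Ioc (0 : ℝ) t), 0 ≤ kernel a b c d t s)
    (hg : IsSolution (kernel a b c d) r g) {γ : ℝ} (hγ : γ = exponent a b) :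
    ∃ M : ℝ, ∀ t : ℝ, 2 ≤ t → g t ≤ M * t ^ γ := by
  obtain ⟨G, hG, hgG⟩ := hg.exists_bound 2
  obtain ⟨C, hC, hexp⟩ :=
    hc.exists_testFunction_expansion (T := 2) (by norm_num) G (-1) hγ
  obtain ⟨z, hz, -, -, -, hrz⟩ := hc.exp_moments
  have hz0 : 0 < z := by linarith
  obtain ⟨Cr, hCr, hr⟩ := hrz.exists_bound
  obtain ⟨Cz, hCz, hzb⟩ := exists_rpow_mul_le hz (γ - 2)
  have hA := hc.first_moment_pos
  set A := ∫ s in Ioi (0 : ℝ), s * a s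
  obtain ⟨T', hT'⟩ := exists_mul_rpow_lt (half_pos hA) (C + Cr * Cz) γ
  set T := max T' 2 with hT
  set f : ℝ → ℝ := fun t => t ^ γ + (-1) * t ^ (γ - 1 / 2) with hf
  -- The cut-off is `2` because `f` vanishes at `1` and is positive only beyond.
  have hfc : ContinuousOn f (Ici 2) := continuousOn_testFunction (by norm_num) γ (-1)
  have hfpos : ∀ t : ℝ, 2 ≤ t → 0 < f t := fun t ht => by
    have := Real.rpow_lt_rpow_of_exponent_lt (by linarith : 1 < t)
      (by linarith : γ - 1 / 2 < γ)
    simp only [hf]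
    linarith
  have hgc : ContinuousOn g (Ici 2) :=
    hg.continuousOn.mono (Ici_subset_Ioi.2 two_pos)
  obtain ⟨K, hK⟩ := (isCompact_Icc (a := (2 : ℝ)) (b := T)).bddAbove_image
    (f := fun t => g t / f t) ((hgc.mono Icc_subset_Ici_self).div
      (hfc.mono Icc_subset_Ici_self) fun t ht => (hfpos t ht.1).ne')
  -- `K + 1` makes the inequality strict on `[2, T]`; `1 ≤ M` gives `g ≤ M * G` below the cut-off
  -- and lets the gain `M * (A / 2) * t ^ (γ - 3 / 2)` absorb `r`.
  set M := max 1 (K + 1) with hM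
  have hM1 : 1 ≤ M := le_max_left _ _
  have key : ∀ t : ℝ, 2 ≤ t → 0 < M * f t - g t := by
    refine forall_pos_of_step (T₂ := T) ((continuousOn_const.mul hfc).sub hgc) ?_ ?_
    · intro t ht
      have h1 : g t / f t ≤ K := hK (mem_image_of_mem _ ht)
      have h2 : K + 1 ≤ M := le_max_right _ _
      have h3 := hfpos t ht.1
      rw [div_le_iff₀ h3] at h1
      nlinarith
    · intro t ht hprev
      have ht2 : 2 ≤ t := (le_max_right _ _).trans ht.le
      have ht0 : 0 < t := by linarith
      set F := fun s => cutRpow 2 G γ (t - s) + (-1) * cutRpow 2 0 (γ - 1 / 2) (t - s) with hF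
      have hgF : ∀ s ∈ Ioc 0 t, g (t - s) ≤ M * F s := by
        intro s hs
        rcases le_or_gt 2 (t - s) with h | h
        · have := hprev (t - s) ⟨h, by linarith [hs.1]⟩
          simp only [hF, cutRpow_of_le h]
          simp only [hf] at this
          linarith
        · have h0 : 0 ≤ t - s := by linarith [hs.2]
          simp only [hF, cutRpow_of_lt h0 h]
          have := hgG (t - s) ⟨h0, h.le⟩
          nlinarith
      have hki := hc.kernel_intervalIntegrable ht0
      have hFi : IntervalIntegrable (fun s => kernel a b c d t s * F s) volume 0 t := by
        have h1 := (intervalIntegrable_mul_cutRpow (by norm_num) ht2 G γ hki).add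
          ((intervalIntegrable_mul_cutRpow (by norm_num) ht2 0 (γ - 1 / 2) hki).const_mul (-1))
        refine h1.congr (fun s _ => ?_)
        simp only [hF]
        ring
      have hle : ∫ s in (0 : ℝ)..t, kernel a b c d t s * g (t - s)
          ≤ M * ∫ s in (0 : ℝ)..t, kernel a b c d t s * F s := by
        rw [← intervalIntegral.integral_const_mul]
        refine intervalIntegral.integral_mono_ae_restrict ht0.le
          (hg.intervalIntegrable_mul ht0 hki) (hFi.const_mul M) ?_
        rw [← Measure.restrict_congr_set Ioc_ae_eq_Icc]
        filter_upwards [hw t ht0, ae_restrict_mem measurableSet_Ioc] with s hs hs'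
        calc kernel a b c d t s * g (t - s) ≤ kernel a b c d t s * (M * F s) := by
              gcongr
              exact hgF s hs'
          _ = _ := by ring
      have hup := (abs_le.1 (hexp t ht2)).2
      have hrt : r t ≤ Cr * Cz * t ^ (γ - 2) := by
        calc r t = (r t * z ^ t) * z ^ (-t) := by
              rw [mul_assoc, ← Real.rpow_add hz0]; simp
          _ ≤ Cr * (Cz * t ^ (γ - 2)) := by
              gcongr
              · exact hr t (by linarith)
              · exact hzb t (by linarith)
          _ = _ := by ring
      have hlt := hT' t ((le_max_left _ _).trans_lt ht)
      have heq := hg.equation t ht0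
      have hF' : ∫ s in (0 : ℝ)..t, kernel a b c d t s * F s
          ≤ f t - A / 2 * t ^ (γ - 3 / 2) + C * t ^ (γ - 2) := by
        simp only [hf, hF]
        linarith
      have hCp : 0 ≤ Cr * Cz * t ^ (γ - 2) := by positivity
      have h5 : M * (∫ s in (0 : ℝ)..t, kernel a b c d t s * F s)
          ≤ M * (f t - A / 2 * t ^ (γ - 3 / 2) + C * t ^ (γ - 2)) := by gcongr
      nlinarith
  refine ⟨M, fun t ht => ?_⟩
  have h1 := key t ht
  have h2 : 0 < t ^ (γ - 1 / 2) := Real.rpow_pos_of_pos (by linarith) _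
  simp only [hf] at h1
  nlinarith

/-- Lower bound: comparison with the subsolution `t ^ γ + t ^ (γ - 1/2)`. -/
lemma IsSolution.exists_mul_rpow_le (hc : Conditions a b c r d)
    (hw : ∀ t, 0 < t → ∀ᵐ s ∂volume.restrict (Ioc (0 : ℝ) t), 0 ≤ kernel a b c d t s)
    (hg : IsSolution (kernel a b c d) r g) (hpos : ∀ T : ℝ, 0 < T → ∃ t, T < t ∧ 0 < g t)
    {γ : ℝ} (hγ : γ = exponent a b) :
    ∃ m : ℝ, 0 < m ∧ ∀ᶠ t : ℝ in atTop, m * t ^ γ ≤ g t := by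
  obtain ⟨T₀, hT₀⟩ := eventually_atTop.1 (hg.eventually_pos hc hw hpos)
  set T₁ := max T₀ 1 with hT₁
  have hT₁1 : 1 ≤ T₁ := le_max_right _ _
  have hgpos : ∀ t : ℝ, T₁ ≤ t → 0 < g t := fun t ht => hT₀ t ((le_max_left _ _).trans ht)
  -- Cutting off by `0` suffices from below, as `g ≥ 0`.
  obtain ⟨C, hC, hexp⟩ := hc.exists_testFunction_expansion hT₁1 0 1 hγ
  have hA := hc.first_moment_pos
  set A := ∫ s in Ioi (0 : ℝ), s * a s
  obtain ⟨T', hT'⟩ := exists_mul_rpow_lt (half_pos hA) C γ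
  set T := max T' T₁ with hT
  set f : ℝ → ℝ := fun t => t ^ γ + 1 * t ^ (γ - 1 / 2) with hf
  have hfc : ContinuousOn f (Ici T₁) := continuousOn_testFunction (by linarith) γ 1
  have hfpos : ∀ t : ℝ, T₁ ≤ t → 0 < f t := fun t ht => by
    have : 0 < t := by linarith
    positivity
  have hgc : ContinuousOn g (Ici T₁) :=
    hg.continuousOn.mono (Ici_subset_Ioi.2 (by linarith))
  obtain ⟨t₀, ht₀, hmin⟩ := (isCompact_Icc (a := T₁) (b := T)).exists_isMinOn
    (f := fun t => g t / f t) ⟨T₁, le_rfl, le_max_right _ _⟩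
    ((hgc.mono Icc_subset_Ici_self).div (hfc.mono Icc_subset_Ici_self)
      fun t ht => (hfpos t ht.1).ne')
  have hq : 0 < g t₀ / f t₀ := div_pos (hgpos t₀ ht₀.1) (hfpos t₀ ht₀.1)
  -- Half the minimal ratio, for strictness on `[T₁, T]`.
  set m := g t₀ / f t₀ / 2 with hm
  have hm0 : 0 < m := half_pos hq
  have key : ∀ t : ℝ, T₁ ≤ t → 0 < g t - m * f t := by
    refine forall_pos_of_step (T₂ := T) (hgc.sub (continuousOn_const.mul hfc)) ?_ ?_
    · intro t ht
      have h1 : g t₀ / f t₀ ≤ g t / f t := hmin ht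
      have h3 := hfpos t ht.1
      rw [le_div_iff₀ h3] at h1
      have h2 : 2 * m = g t₀ / f t₀ := by rw [hm]; ring
      rw [← h2] at h1
      nlinarith
    · intro t ht hprev
      have ht1 : T₁ ≤ t := (le_max_right _ _).trans ht.le
      have ht0 : 0 < t := by linarith
      set F := fun s => cutRpow T₁ 0 γ (t - s) + 1 * cutRpow T₁ 0 (γ - 1 / 2) (t - s) with hF
      have hgF : ∀ s ∈ Ioc 0 t, m * F s ≤ g (t - s) := by
        intro s hs
        rcases le_or_gt T₁ (t - s) with h | h
        · have := hprev (t - s) ⟨h, by linarith [hs.1]⟩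
          simp only [hF, cutRpow_of_le h]
          simp only [hf] at this
          linarith
        · have h0 : 0 ≤ t - s := by linarith [hs.2]
          simp only [hF, cutRpow_of_lt h0 h]
          simpa using hg.nonneg _ h0
      have hki := hc.kernel_intervalIntegrable ht0
      have hFi : IntervalIntegrable (fun s => kernel a b c d t s * F s) volume 0 t := by
        have h1 := (intervalIntegrable_mul_cutRpow hT₁1 ht1 0 γ hki).add
          ((intervalIntegrable_mul_cutRpow hT₁1 ht1 0 (γ - 1 / 2) hki).const_mul 1)
        refine h1.congr (fun s _ => ?_)
        simp only [hF]
        ring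
      have hle : m * ∫ s in (0 : ℝ)..t, kernel a b c d t s * F s
          ≤ ∫ s in (0 : ℝ)..t, kernel a b c d t s * g (t - s) := by
        rw [← intervalIntegral.integral_const_mul]
        refine intervalIntegral.integral_mono_ae_restrict ht0.le
          (hFi.const_mul m) (hg.intervalIntegrable_mul ht0 hki) ?_
        rw [← Measure.restrict_congr_set Ioc_ae_eq_Icc]
        filter_upwards [hw t ht0, ae_restrict_mem measurableSet_Ioc] with s hs hs'
        calc m * (kernel a b c d t s * F s) = kernel a b c d t s * (m * F s) := by ring
          _ ≤ kernel a b c d t s * g (t - s) := by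
              gcongr
              exact hgF s hs'
      have hlow := (abs_le.1 (hexp t ht1)).1
      have hlt := hT' t ((le_max_left _ _).trans_lt ht)
      have heq := hg.equation t ht0
      have hrt := hc.r_nonneg t ht0.le
      have hF' : f t < ∫ s in (0 : ℝ)..t, kernel a b c d t s * F s := by
        simp only [hf, hF]
        linarith
      have h5 := mul_lt_mul_of_pos_left hF' hm0
      linarith
  refine ⟨m, hm0, eventually_atTop.2 ⟨T₁, fun t ht => ?_⟩⟩
  have h1 := key t ht
  have h2 : 0 < t ^ (γ - 1 / 2) := Real.rpow_pos_of_pos (by linarith) _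
  simp only [hf] at h1
  nlinarith

/-! ### The scaled solution -/

/-- Comparison covers `[2, ∞)` and compactness `[T, 2]`; `T > 0` matters because `t ^ (-γ)` blows up
at `0` when `γ > 0`. -/
lemma IsSolution.exists_scaled_le (hc : Conditions a b c r d)
    (hw : ∀ t, 0 < t → ∀ᵐ s ∂volume.restrict (Ioc (0 : ℝ) t), 0 ≤ kernel a b c d t s)
    (hg : IsSolution (kernel a b c d) r g) {γ : ℝ} (hγ : γ = exponent a b) {T : ℝ} (hT : 0 < T) :
    ∃ M : ℝ, ∀ t : ℝ, T ≤ t → g t * t ^ (-γ) ≤ M := by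
  obtain ⟨M, hM⟩ := hg.exists_le_mul_rpow hc hw hγ
  have hgc : ContinuousOn (fun t => g t * t ^ (-γ)) (Icc T 2) :=
    (hg.continuousOn.mono fun x hx => hT.trans_le hx.1).mul
      (continuousOn_id.rpow_const fun t ht => Or.inl (hT.trans_le ht.1).ne')
  obtain ⟨K, hK⟩ := isCompact_Icc.bddAbove_image hgc
  refine ⟨max M K, fun t ht => ?_⟩
  rcases le_total t 2 with h | h
  · exact (hK (mem_image_of_mem _ ⟨ht, h⟩)).trans (le_max_right _ _)
  · have ht0 : 0 < t := by linarith
    refine le_trans ?_ (le_max_left _ _)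
    rw [Real.rpow_neg ht0.le, ← div_eq_mul_inv, div_le_iff₀ (by positivity)]
    exact hM t h

lemma iSup_scaled_lt_top {γ M : ℝ} {I : Set ℝ} (h : ∀ t ∈ I, g t * t ^ (-γ) ≤ M) :
    (⨆ t ∈ I, scaled g γ t) < ⊤ :=
  (iSup₂_le fun t ht => EReal.coe_le_coe_iff.2 (h t ht)).trans_lt (EReal.coe_lt_top M)

lemma liminf_scaled_le_iSup (γ T : ℝ) :
    liminf (scaled g γ) atTop ≤ ⨆ t ∈ Ici T, scaled g γ t := by
  refine liminf_le_of_frequently_le' (Eventually.frequently ?_)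
  filter_upwards [eventually_ge_atTop T] with t ht
  exact le_iSup₂ (f := fun t (_ : t ∈ Ici T) => scaled g γ t) t ht

end VolterraRenewal

theorem theorem2 (a b : ℝ → ℝ) (c : ℝ → ℝ → ℝ) (r g : ℝ → ℝ) (d γ : ℝ)
    (hcond : VolterraRenewal.Conditions a b c r d)
    (hw : ∀ t, 0 < t → ∀ᵐ s ∂volume.restrict (Ioc (0 : ℝ) t),
      0 ≤ VolterraRenewal.kernel a b c d t s)
    (hg : VolterraRenewal.IsSolution (VolterraRenewal.kernel a b c d) r g)
    (hpos : ∀ T : ℝ, 0 < T → ∃ t, T < t ∧ 0 < g t)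
    (hγ : γ = VolterraRenewal.exponent a b) :
    0 < liminf (VolterraRenewal.scaled g γ) atTop ∧
    (∀ T : ℝ, 0 < T →
      liminf (VolterraRenewal.scaled g γ) atTop ≤ (⨆ t ∈ Ici T, VolterraRenewal.scaled g γ t) ∧
      (⨆ t ∈ Ici T, VolterraRenewal.scaled g γ t) < ⊤) ∧
    (γ ≤ 0 →
      liminf (VolterraRenewal.scaled g γ) atTop ≤
        (⨆ t ∈ Ici (0 : ℝ), VolterraRenewal.scaled g γ t) ∧
      (⨆ t ∈ Ici (0 : ℝ), VolterraRenewal.scaled g γ t) < ⊤) := by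
  refine ⟨?_, fun T hT => ⟨VolterraRenewal.liminf_scaled_le_iSup γ T, ?_⟩,
    fun hγ0 => ⟨VolterraRenewal.liminf_scaled_le_iSup γ 0, ?_⟩⟩
  · obtain ⟨m, hm, hev⟩ := hg.exists_mul_rpow_le hcond hw hpos hγ
    refine lt_of_lt_of_le (EReal.coe_pos.2 hm) (le_liminf_of_le (by isBoundedDefault) ?_)
    filter_upwards [hev, eventually_gt_atTop 0] with t ht ht0
    refine EReal.coe_le_coe_iff.2 ?_
    rw [Real.rpow_neg ht0.le, ← div_eq_mul_inv, le_div_iff₀ (by positivity)]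
    exact ht
  · obtain ⟨M, hM⟩ := hg.exists_scaled_le hcond hw hγ hT
    exact VolterraRenewal.iSup_scaled_lt_top hM
  · obtain ⟨M, hM⟩ := hg.exists_scaled_le hcond hw hγ one_pos
    obtain ⟨G, hG, hgG⟩ := hg.exists_bound 1
    refine VolterraRenewal.iSup_scaled_lt_top (M := max M G) fun t ht => ?_
    rcases le_total t 1 with h | h
    · refine le_trans ?_ (le_max_right _ _)
      -- This includes `t = 0`, with `0 ^ 0 = 1` if `γ = 0`.
      have h1 : t ^ (-γ) ≤ 1 := Real.rpow_le_one ht h (by linarith)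
      calc g t * t ^ (-γ) ≤ g t * 1 := by
            gcongr
            exact hg.nonneg t ht
        _ ≤ G := by rw [mul_one]; exact hgG t ⟨ht, h⟩
    · exact (hM t h).trans (le_max_left _ _)
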